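/- Let $A$ be a (unital, associative, not necessarily commutative) ring and $C$ a left $A$-module. Over any ring $R$ and for a left $R$-module $C$, let $\operatorname{Prod} C$ be the class of modules isomorphic to a direct summand of a product of copies of $C$, and let $\operatorname{Cogen} C$ be the class of modules that embed in a module from $\operatorname{Prod} C$. We use the following notions. - $C$ is *cosilting* if there is an exact sequence $0\to C\to E_0\xrightarrow{\omega}E_1$ with $E_0,E_1$ injective such that $\operatorname{Cogen} C$ is the class of all modules $X$ for which $\operatorname{Hom}(X,\omega):\operatorname{Hom}(X,E_0)\to\operatorname{Hom}(X,E_1)$ is surjective. - $C$ is *cotilting* if $\operatorname{Cogen} C=\{X\mid \operatorname{Ext}^1(X,C)=0\}$. - A class $\mathcal F$ of modules is *torsionfree* if there is a class $\mathcal T$ with $\mathcal T=\{X\mid \operatorname{Hom}(X,Y)=0 \text{ for all } Y\in\mathcal F\}$ and $\mathcal F=\{Y\mid \operatorname{Hom}(X,Y)=0 \text{ for all } X\in\mathcal T\}$. - A module $M$ is *Ext-injective* in a class $\mathcal F$ if $M\in\mathcal F$ and $\operatorname{Ext}^1(X,M)=0$ for all $X\in\mathcal F$. - A map $g:M\to N$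 is a *right $\mathcal F$-approximation* if $M\in\mathcal F$ and every map $X\to N$ with $X\in\mathcal F$ factors through $g$. **Theorem.** The following statements are equivalent. 1. $C$ is a cosilting $A$-module. 2. $\operatorname{Cogen} C$ is a torsionfree class of left $A$-modules, and $C$ is cotilting as a left module over $A/\operatorname{Ann} C$. 3. $C$ is Ext-injective in $\operatorname{Cogen} C$, and there are an injective cogenerator $E$ of the category of left $A$-modules and an exact sequence $0\to C_1\to C_0\xrightarrow{g}E$ such that $C_1,C_0\in\operatorname{Prod} C$ and $g$ is a right $\operatorname{Cogen} C$-approximation. -/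

import Mathlib

open CategoryTheory

universe u v

namespace CosiltingModules

section

variable {A : Type u} [Ring A]

/-- `Prod C`: the left `A`-modules isomorphic to a direct summand of a product of copies of `C`. -/
def ProdClass (C : ModuleCat.{v} A) : ObjectProperty (ModuleCat.{v} A) := fun M =>
  ∃ (I : Type v) (D : ModuleCat.{v} A), Nonempty ((M × D) ≃ₗ[A] (I → C))

/-- `Cogen C`: the left `A`-modules that embed in a module from `Prod C`. -/
def Cogen (C : ModuleCat.{v} A) : ObjectProperty (ModuleCat.{v} A) := fun X =>
  ∃ N : ModuleCat.{v} A, ProdClass C N ∧ ∃ f : X →ₗ[A] N, Function.Injective f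

/-- The class of modules `X` for which `Hom_A(X, ω)` is surjective. -/
def HomSurjClass {E₀ E₁ : ModuleCat.{v} A} (ω : E₀ →ₗ[A] E₁) :
    ObjectProperty (ModuleCat.{v} A) := fun X =>
  ∀ h : X →ₗ[A] E₁, ∃ k : X →ₗ[A] E₀, ω ∘ₗ k = h

/-- `0 → C → E₀ → E₁`, with maps `ι` and `ω`, is an injective copresentation of `C`. -/
structure IsInjectiveCopresentation {C E₀ E₁ : ModuleCat.{v} A}
    (ι : C →ₗ[A] E₀) (ω : E₀ →ₗ[A] E₁) : Prop where
  injective_left : Module.Injective A E₀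
  injective_right : Module.Injective A E₁
  mono : Function.Injective ι
  exact : Function.Exact ι ω

/-- `C` is a cosilting module: it has an injective copresentation `0 → C → E₀ → E₁`, with
second map `ω`, such that `Cogen C` is the class of all `X` with `Hom_A(X, ω)` surjective. -/
def IsCosilting (C : ModuleCat.{v} A) : Prop :=
  ∃ (E₀ E₁ : ModuleCat.{v} A) (ι : C →ₗ[A] E₀) (ω : E₀ →ₗ[A] E₁),
    IsInjectiveCopresentation ι ω ∧ Cogen C = HomSurjClass ω

/-- `(T, F)` is a torsion pair: each of the two classes is the `Hom`-orthogonal of the other. -/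
structure IsTorsionPair (T F : ObjectProperty (ModuleCat.{v} A)) : Prop where
  torsion_iff : ∀ X : ModuleCat.{v} A,
    T X ↔ ∀ Y : ModuleCat.{v} A, F Y → ∀ f : X →ₗ[A] Y, f = 0
  torsionfree_iff : ∀ Y : ModuleCat.{v} A,
    F Y ↔ ∀ X : ModuleCat.{v} A, T X → ∀ f : X →ₗ[A] Y, f = 0

/-- `F` is a torsionfree class: the second class of some torsion pair. -/
def IsTorsionfreeClass (F : ObjectProperty (ModuleCat.{v} A)) : Prop :=
  ∃ T : ObjectProperty (ModuleCat.{v} A), IsTorsionPair T F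

/-- `E` is an injective cogenerator of the category of left `A`-modules. -/
def IsInjectiveCogenerator (E : ModuleCat.{v} A) : Prop :=
  Module.Injective A E ∧ IsCoseparator E

/-- `g : M → N` is a right `F`-approximation of `N`: `M` lies in `F`, and every map to `N` from
a module in `F` factors through `g`. -/
def IsRightApproximation (F : ObjectProperty (ModuleCat.{v} A)) {M N : ModuleCat.{v} A}
    (g : M →ₗ[A] N) : Prop :=
  F M ∧ ∀ X : ModuleCat.{v} A, F X → ∀ h : X →ₗ[A] N, ∃ k : X →ₗ[A] M, g ∘ₗ k = h

/-- The kernel of `Ext¹_A(-, C)`. -/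
def KerExtOne [Small.{v} A] (C : ModuleCat.{v} A) : ObjectProperty (ModuleCat.{v} A) := fun X =>
  Subsingleton (Abelian.Ext.{v} X C 1)

/-- `M` is Ext-injective in `F`: it lies in `F`, and `Ext¹_A(X, M) = 0` for all `X` in `F`. -/
def IsExtInjective [Small.{v} A] (F : ObjectProperty (ModuleCat.{v} A))
    (M : ModuleCat.{v} A) : Prop :=
  F M ∧ ∀ X : ModuleCat.{v} A, F X → KerExtOne M X

/-- `C` is a cotilting module: `Cogen C` is the kernel of `Ext¹_A(-, C)`. -/
def IsCotilting [Small.{v} A] (C : ModuleCat.{v} A) : Prop :=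
  Cogen C = KerExtOne C

/-- `C` as a left module over `A / Ann C`. -/
def overQuotientAnn (C : ModuleCat.{v} A) : ModuleCat.{v} (A ⧸ Module.annihilator A C) :=
  letI : Module (A ⧸ Module.annihilator A C) C := Module.quotientAnnihilator
  ModuleCat.of (A ⧸ Module.annihilator A C) C

instance small_quotient_ideal [Small.{v} A] (I : Ideal A) : Small.{v} (A ⧸ I) :=
  small_of_surjective (Submodule.Quotient.mk_surjective I)

end

end CosiltingModules

/-! Everything is tested on elements over `A`: membership in `Cogen C` means that maps to `C`
separate points (`cogen_iff`), and Ext¹(X, C) = 0 means that maps to `C` extend from the kernel of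
any surjection onto X (`kerExtOne_iff`).

If C is cosilting, surjectivity of Hom(X, ω) forces Ext¹(X, C) = 0. Hence `Cogen C` is closed under
extensions, and so torsionfree. A module killed by Ann C is a quotient of one in `Cogen C`;
vanishing of Ext over A/Ann C lets lifts along ω descend to that quotient.

From a torsionfree class and cotilting: an extension of X in `Cogen C` by C stays in `Cogen C`, is
therefore killed by Ann C, and splits. The approximation is a dual Bongartz construction, an
extension 0 → C^J → P → W → 0 of the largest submodule W of E killed by Ann C.

From an approximation to cosilting: ω is (α, 0) : I₀ → I₁ × E', with α an essential copresentation
of C and E' an injective module cogenerating the modules that receive no nonzero map from `Cogen C`.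
The approximation g yields an injective copresentation of C₁ which exceeds the essential one only by
a summand cogenerated by E'. If Hom(X, ω) is surjective, this makes every map X → E factor through
g, so C₀ separates the points of X. -/

namespace CosiltingModules

/-! ### Cogenerated modules and torsionfree classes -/

section Basic

variable (A : Type u) [Ring A]

/-- Linear maps from `X` to `C` separate the points of `X`. -/
def IsCogeneratedBy (C X : Type*) [AddCommGroup C] [Module A C] [AddCommGroup X] [Module A X] :
    Prop :=
  ∀ x : X, x ≠ 0 → ∃ f : X →ₗ[A] C, f x ≠ 0

/-- Every short exact sequence `0 → N → Y → X → 0` of modules of universe `v` has the property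
that maps `N → M` extend to `Y`; equivalently `Ext¹(X, M) = 0`. -/
def ExtVanishes (M X : Type*) [AddCommGroup M] [Module A M] [AddCommGroup X] [Module A X] :
    Prop :=
  ∀ (Y : Type v) [AddCommGroup Y] [Module A Y] (p : Y →ₗ[A] X), Function.Surjective p →
    ∀ f : LinearMap.ker p →ₗ[A] M, ∃ g : Y →ₗ[A] M, ∀ y : LinearMap.ker p, g y = f y

variable {A}
variable {C X Y Z M N : Type*} [AddCommGroup C] [Module A C] [AddCommGroup X] [Module A X]
  [AddCommGroup Y] [Module A Y] [AddCommGroup Z] [Module A Z] [AddCommGroup M] [Module A M]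
  [AddCommGroup N] [Module A N]

theorem IsCogeneratedBy.refl : IsCogeneratedBy A C C := fun _ hx => ⟨LinearMap.id, hx⟩

theorem IsCogeneratedBy.of_injective (hY : IsCogeneratedBy A C Y) (f : X →ₗ[A] Y)
    (hf : Function.Injective f) : IsCogeneratedBy A C X := fun x hx => by
  obtain ⟨g, hg⟩ := hY (f x) (by simpa using (map_ne_zero_iff f hf).2 hx)
  exact ⟨g ∘ₗ f, hg⟩

theorem IsCogeneratedBy.submodule (hY : IsCogeneratedBy A C Y) (S : Submodule A Y) :
    IsCogeneratedBy A C S :=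
  hY.of_injective S.subtype S.subtype_injective

theorem IsCogeneratedBy.pi (I : Type*) : IsCogeneratedBy A C (I → C) := fun x hx => by
  obtain ⟨i, hi⟩ := Function.ne_iff.1 hx
  exact ⟨LinearMap.proj i, hi⟩

theorem IsCogeneratedBy.of_separates (h : ∀ x : X, x ≠ 0 → ∃ f : X →ₗ[A] Y, f x ≠ 0)
    (hY : IsCogeneratedBy A C Y) : IsCogeneratedBy A C X := fun x hx => by
  obtain ⟨f, hf⟩ := h x hx
  obtain ⟨g, hg⟩ := hY _ hf
  exact ⟨g ∘ₗ f, hg⟩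

theorem IsCogeneratedBy.smul_eq_zero (hX : IsCogeneratedBy A C X) {a : A}
    (ha : a ∈ Module.annihilator A C) (x : X) : a • x = 0 := by
  by_contra h
  obtain ⟨f, hf⟩ := hX _ h
  exact hf (by rw [map_smul, Module.mem_annihilator.1 ha])

theorem ProdClass.exists_retraction {A : Type u} [Ring A] {C M : ModuleCat.{v} A}
    (h : ProdClass C M) : ∃ (I : Type v) (i : M →ₗ[A] (I → C)) (r : (I → C) →ₗ[A] M),
      ∀ x, r (i x) = x := by
  obtain ⟨I, D, ⟨e⟩⟩ := h
  exact ⟨I, e.toLinearMap ∘ₗ LinearMap.inl A M D, LinearMap.fst A M D ∘ₗ e.symm.toLinearMap,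
    fun x => by simp⟩

theorem ProdClass.of_retraction {A : Type u} [Ring A] {C M : ModuleCat.{v} A} {I : Type v}
    (i : M →ₗ[A] (I → C)) (r : (I → C) →ₗ[A] M) (h : ∀ x, r (i x) = x) : ProdClass C M := by
  refine ⟨I, ModuleCat.of A (LinearMap.ker r), ⟨?_⟩⟩
  refine LinearEquiv.ofBijective (i.coprod (LinearMap.ker r).subtype) ⟨?_, fun y => ?_⟩
  · rw [injective_iff_map_eq_zero]
    rintro ⟨x, y⟩ hxy
    have hxy' : i x + y.1 = 0 := by simpa using hxy
    have hx : x = 0 := by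
      have := congrArg r hxy'
      rwa [map_add, h, LinearMap.mem_ker.1 y.2, add_zero, map_zero] at this
    subst hx
    have hy : y = 0 := Subtype.ext (by simpa using hxy')
    rw [hy]; rfl
  · exact ⟨(r y, ⟨y - i (r y), by simp [h]⟩), by simp⟩

theorem ProdClass.isCogeneratedBy {A : Type u} [Ring A] {C M : ModuleCat.{v} A}
    (h : ProdClass C M) : IsCogeneratedBy A C M := by
  obtain ⟨I, i, r, hri⟩ := h.exists_retraction
  exact (IsCogeneratedBy.pi I).of_injective i (Function.LeftInverse.injective hri)

/-- Evaluation embeds X into the power of C indexed by Hom(X, C) as soon as maps to C separate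
points. -/
theorem cogen_iff {A : Type u} [Ring A] {C X : ModuleCat.{v} A} :
    Cogen C X ↔ IsCogeneratedBy A C X := by
  constructor
  · rintro ⟨N, hN, f, hf⟩
    exact hN.isCogeneratedBy.of_injective f hf
  · intro h
    refine ⟨ModuleCat.of A ((X →ₗ[A] C) → C), ⟨X →ₗ[A] C, ModuleCat.of A PUnit,
      ⟨LinearEquiv.prodUnique⟩⟩, LinearMap.pi fun f => f, ?_⟩
    rw [injective_iff_map_eq_zero]
    intro x hx
    by_contra h0
    obtain ⟨f, hf⟩ := h x h0
    exact hf (congrFun hx f)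

theorem prodClass_pi {A : Type u} [Ring A] (C : ModuleCat.{v} A) (I : Type v) :
    ProdClass C (ModuleCat.of A (I → C)) :=
  .of_retraction (I := I) LinearMap.id LinearMap.id fun _ => rfl

theorem ExtVanishes.of_retraction (h : ExtVanishes.{u, v} A M X) (i : N →ₗ[A] M) (r : M →ₗ[A] N)
    (hri : ∀ x, r (i x) = x) : ExtVanishes.{u, v} A N X := fun Y _ _ p hp f => by
  obtain ⟨g, hg⟩ := h Y p hp (i ∘ₗ f)
  exact ⟨r ∘ₗ g, fun y => by simp [hg, hri]⟩

theorem ExtVanishes.pi (h : ExtVanishes.{u, v} A M X) (I : Type*) :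
    ExtVanishes.{u, v} A (I → M) X := fun Y _ _ p hp f => by
  choose g hg using fun i => h Y p hp (LinearMap.proj i ∘ₗ f)
  exact ⟨LinearMap.pi g, fun y => funext fun i => hg i y⟩

/-- A class of modules cogenerated by an Ext-injective object is closed under extensions. -/
theorem IsCogeneratedBy.of_extension {Y : Type v} [AddCommGroup Y] [Module A Y]
    (p : Y →ₗ[A] X) (hX : IsCogeneratedBy A C X)
    (hker : IsCogeneratedBy A C (LinearMap.ker p))
    (hext : ExtVanishes.{u, v} A C (LinearMap.range p)) : IsCogeneratedBy A C Y := fun y hy => by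
  by_cases h : p y = 0
  · obtain ⟨f, hf⟩ := hker ⟨y, h⟩ fun h0 => hy (congrArg Subtype.val h0)
    have hk : LinearMap.ker p.rangeRestrict = LinearMap.ker p := p.ker_rangeRestrict
    obtain ⟨g, hg⟩ := hext Y p.rangeRestrict p.surjective_rangeRestrict
      (f ∘ₗ (LinearEquiv.ofEq _ _ hk).toLinearMap)
    refine ⟨g, ?_⟩
    have := hg ⟨y, by rw [hk]; exact h⟩
    simp only [LinearMap.comp_apply] at this
    rw [this]
    exact hf
  · obtain ⟨f, hf⟩ := hX _ h
    exact ⟨f ∘ₗ p, hf⟩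

/-- The class of modules cogenerated by `C` is closed under extensions. -/
def CogenClosedUnderExtensions (A : Type u) [Ring A] (C : Type v) [AddCommGroup C] [Module A C] :
    Prop :=
  ∀ (Y X : Type v) [AddCommGroup Y] [Module A Y] [AddCommGroup X] [Module A X] (p : Y →ₗ[A] X),
    IsCogeneratedBy A C X → IsCogeneratedBy A C (LinearMap.ker p) → IsCogeneratedBy A C Y

/-- The torsion part of Y is `t`, the common kernel of all maps Y → C. Extension closure is what
shows that `t` itself has no nonzero map to C. -/
theorem isTorsionfreeClass_cogen {A : Type u} [Ring A] {C : ModuleCat.{v} A}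
    (h : CogenClosedUnderExtensions A C) : IsTorsionfreeClass (Cogen C) := by
  refine ⟨fun X => ∀ Y, Cogen C Y → ∀ f : X →ₗ[A] Y, f = 0, fun X => Iff.rfl, fun Y =>
    ⟨fun hY X hX f => hX Y hY f, fun hY => ?_⟩⟩
  let t : Submodule A Y := ⨅ f : Y →ₗ[A] C, LinearMap.ker f
  have ht : ∀ y, y ∈ t ↔ ∀ f : Y →ₗ[A] C, f y = 0 := fun y => by simp [t]
  have key : ∀ f : t →ₗ[A] C, f = 0 := by
    intro f
    -- Y/S is an extension of Y/t by t/ker f, which f embeds in C. So Y/S is cogenerated by C, while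
    -- every map Y → C kills `t`; hence t = ker f.
    let S : Submodule A Y := (LinearMap.ker f).map t.subtype
    let q : (Y ⧸ S) →ₗ[A] (Y ⧸ t) := Submodule.mapQ S t LinearMap.id (by
      rintro _ ⟨y, -, rfl⟩; exact y.2)
    have hYt : IsCogeneratedBy A C (Y ⧸ t) := by
      intro y hy
      obtain ⟨y, rfl⟩ := t.mkQ_surjective y
      have hy' : ¬ y ∈ t := by simpa using hy
      rw [ht] at hy'
      push Not at hy'
      obtain ⟨g, hg⟩ := hy'
      exact ⟨t.liftQ g fun z hz => (ht z).1 hz g, hg⟩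
    have hq : ∀ z : LinearMap.ker q, ∃ y : t, S.mkQ y = z := by
      rintro ⟨z, hz⟩
      obtain ⟨y, rfl⟩ := S.mkQ_surjective z
      exact ⟨⟨y, by simpa [q] using hz⟩, rfl⟩
    have hker : IsCogeneratedBy A C (LinearMap.ker q) := by
      let j : t →ₗ[A] LinearMap.ker q := (S.mkQ ∘ₗ t.subtype).codRestrict _ fun y => by
        simp [q]
      have hj : Function.Surjective j := fun z => by
        obtain ⟨y, hy⟩ := hq z
        exact ⟨y, Subtype.ext hy⟩
      have hjk : LinearMap.ker j = LinearMap.ker f := by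
        ext y
        rw [LinearMap.mem_ker, ← Subtype.coe_inj]
        change S.mkQ (y : Y) = 0 ↔ _
        simp [S]
      let e := (Submodule.quotEquivOfEq _ _ hjk).symm.trans (j.quotKerEquivOfSurjective hj)
      refine IsCogeneratedBy.refl.of_injective
        ((LinearMap.ker f).liftQ f le_rfl ∘ₗ e.symm.toLinearMap) ?_
      rw [LinearMap.coe_comp]
      exact (LinearMap.ker_eq_bot.1 (Submodule.ker_liftQ_eq_bot _ _ _ le_rfl)).comp
        e.symm.injective
    have hYS := h _ _ q hYt hker
    ext y
    by_contra hy
    have hyS : S.mkQ (y : Y) ≠ 0 := by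
      simpa [S] using hy
    obtain ⟨g, hg⟩ := hYS _ hyS
    exact hg ((ht _).1 y.2 (g ∘ₗ S.mkQ))
  have ht0 : t.subtype = 0 := by
    refine hY (ModuleCat.of A t) (fun Z hZ f => ?_) t.subtype
    ext y
    by_contra hy
    obtain ⟨g, hg⟩ := cogen_iff.1 hZ _ hy
    exact hg (LinearMap.congr_fun (key (g ∘ₗ f)) y)
  rw [cogen_iff]
  intro y hy
  by_contra! hf
  exact hy (LinearMap.congr_fun ht0 ⟨y, (ht y).2 hf⟩)

theorem IsTorsionfreeClass.cogenClosedUnderExtensions {A : Type u} [Ring A] {C : ModuleCat.{v} A}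
    (h : IsTorsionfreeClass (Cogen C)) : CogenClosedUnderExtensions A C := by
  obtain ⟨T, hT⟩ := h
  intro Y X _ _ _ _ p hX hker
  refine cogen_iff.1 ((hT.torsionfree_iff (ModuleCat.of A Y)).2 fun Z hZ f => ?_)
  have hpf : p ∘ₗ f = 0 :=
    (hT.torsionfree_iff (ModuleCat.of A X)).1 (cogen_iff.2 hX) Z hZ (p ∘ₗ f)
  have := (hT.torsionfree_iff (ModuleCat.of A (LinearMap.ker p))).1 (cogen_iff.2 hker) Z hZ
    (f.codRestrict (LinearMap.ker p) fun z => LinearMap.congr_fun hpf z)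
  ext z
  exact congrArg Subtype.val (LinearMap.congr_fun this z)

end Basic

/-! ### Injective hulls and injective cogenerators -/

section Injective

variable {A : Type u} [Ring A]

theorem injective_of_retraction {M N : Type v} [AddCommGroup M] [Module A M] [AddCommGroup N]
    [Module A N] (hM : Module.Injective A M) (i : N →ₗ[A] M) (r : M →ₗ[A] N)
    (hri : ∀ x, r (i x) = x) : Module.Injective A N :=
  ⟨fun X Y _ _ _ _ f hf g => by
    obtain ⟨h, hh⟩ := hM.out f hf (i ∘ₗ g)
    exact ⟨r ∘ₗ h, fun x => by simp [hh, hri]⟩⟩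

theorem exists_injective_embedding [Small.{v} A] (M : Type v) [AddCommGroup M] [Module A M] :
    ∃ E : ModuleCat.{v} A, Module.Injective A E ∧ ∃ i : M →ₗ[A] E, Function.Injective i := by
  obtain ⟨P⟩ := EnoughInjectives.presentation (ModuleCat.of A M)
  have : CategoryTheory.Injective (ModuleCat.of A P.J) := P.injective
  exact ⟨P.J, Module.injective_module_of_injective_object A P.J, P.f.hom,
    (ModuleCat.mono_iff_injective P.f).1 P.mono⟩

/-- Existence of injective hulls. -/
theorem exists_essential_injective_embedding [Small.{v} A] (M : Type v) [AddCommGroup M]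
    [Module A M] : ∃ E : ModuleCat.{v} A, Module.Injective A E ∧ ∃ i : M →ₗ[A] E,
      Function.Injective i ∧ ∀ S : Submodule A E, S ⊓ LinearMap.range i = ⊥ → S = ⊥ := by
  obtain ⟨J, hJ, i, hi⟩ := exists_injective_embedding (A := A) M
  let R := LinearMap.range i
  -- N is a maximal essential extension of R inside J, and K below is a maximal submodule meeting N
  -- trivially. The aim is to show that N is a retract of J.
  obtain ⟨N, hRN, hN⟩ := zorn_le_nonempty₀
    {N : Submodule A J | R ≤ N ∧ ∀ S ≤ N, S ⊓ R = ⊥ → S = ⊥} (by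
      intro c hc hchain N₀ hN₀
      refine ⟨sSup c, ⟨(hc hN₀).1.trans (le_sSup hN₀), fun S hS hSR => ?_⟩,
        fun N hN => le_sSup hN⟩
      rw [Submodule.eq_bot_iff]
      intro s hs
      obtain ⟨N, hN, hsN⟩ := (Submodule.mem_sSup_of_directed ⟨N₀, hN₀⟩ hchain.directedOn).1 (hS hs)
      have := (hc hN).2 (Submodule.span A {s}) (by simpa using hsN) (by
        rw [eq_bot_iff, ← hSR]
        exact inf_le_inf_right _ (by simpa using hs))
      simpa using this) R ⟨le_rfl, fun S hS h => by rwa [inf_eq_left.2 hS] at h⟩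
  obtain ⟨K, -, hK⟩ := zorn_le_nonempty₀ {K : Submodule A J | K ⊓ N = ⊥} (by
      intro c hc hchain K₀ hK₀
      refine ⟨sSup c, ?_, fun K hK => le_sSup hK⟩
      change sSup c ⊓ N = ⊥
      rw [Submodule.eq_bot_iff]
      rintro s ⟨hs, hsN⟩
      obtain ⟨K, hK, hsK⟩ := (Submodule.mem_sSup_of_directed ⟨K₀, hK₀⟩ hchain.directedOn).1 hs
      have := hc hK
      exact (Submodule.eq_bot_iff _).1 this s ⟨hsK, hsN⟩) ⊥ (bot_inf_eq _)
  have hKN : ∀ x ∈ K, x ∈ N → x = 0 := fun x h₁ h₂ =>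
    (Submodule.eq_bot_iff _).1 hK.prop x ⟨h₁, h₂⟩
  have hKmax : ∀ T : Submodule A J, K ≤ T → (∀ x ∈ T, x ∈ N → x = 0) → T ≤ K := fun T hT h =>
    hK.2 ((Submodule.eq_bot_iff _).2 fun x hx => h x hx.1 hx.2) hT
  obtain ⟨φ, hφ⟩ := hJ.out (K.mkQ ∘ₗ N.subtype) (by
    rw [injective_iff_map_eq_zero]
    intro x hx
    exact Subtype.ext (hKN x (by simpa using hx) x.2)) N.subtype
  replace hφ : ∀ x ∈ N, φ (K.mkQ x) = x := fun x hx => hφ ⟨x, hx⟩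
  have hφinj : ∀ x, φ (K.mkQ x) = 0 → x ∈ K := fun x hx =>
    hKmax (LinearMap.ker (φ ∘ₗ K.mkQ)) (fun x hx => by
      have : K.mkQ x = 0 := by simpa using hx
      simp [this]) (fun x hx hxN => by rw [← hφ x hxN]; exact hx) hx
  -- The image of φ is still essential over R, so maximality of N confines it to N.
  have hle : LinearMap.range φ ≤ N := by
    refine hN.2 ⟨hN.prop.1.trans fun x hx => ⟨_, hφ x hx⟩, fun S hS hSR => ?_⟩
      fun x hx => ⟨_, hφ x hx⟩
    have hSN : S ⊓ N = ⊥ := hN.prop.2 _ inf_le_right (by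
      rw [inf_assoc, inf_eq_right.2 hN.prop.1, hSR])
    have hT : S.comap (φ ∘ₗ K.mkQ) ≤ K := hKmax _ (fun x hx => by
      have : K.mkQ x = 0 := by simpa using hx
      simp [this]) fun x hx hxN => by
        refine (Submodule.eq_bot_iff _).1 hSN x ⟨?_, hxN⟩
        rw [← hφ x hxN]; exact hx
    rw [Submodule.eq_bot_iff]
    intro s hs
    obtain ⟨z, rfl⟩ := hS hs
    obtain ⟨x, rfl⟩ := K.mkQ_surjective z
    have : x ∈ K := hT hs
    have : K.mkQ x = 0 := by simpa using this
    rw [this, map_zero]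
  refine ⟨ModuleCat.of A N, injective_of_retraction hJ N.subtype
    ((φ ∘ₗ K.mkQ).codRestrict N fun x => hle ⟨_, rfl⟩) (fun x => Subtype.ext (hφ x x.2)),
    i.codRestrict N fun x => hRN ⟨x, rfl⟩, fun x y h => hi (congrArg Subtype.val h),
    fun S hS => ?_⟩
  have := hN.prop.2 (S.map N.subtype) (by rintro _ ⟨x, -, rfl⟩; exact x.2) (by
    rw [Submodule.eq_bot_iff]
    rintro _ ⟨⟨x, hx, rfl⟩, m, hm⟩
    have := (Submodule.eq_bot_iff _).1 hS x ⟨hx, m, Subtype.ext hm⟩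
    rw [this, map_zero])
  exact (Submodule.eq_bot_iff _).2 fun x hx =>
    Subtype.ext ((Submodule.eq_bot_iff _).1 this x ⟨x, hx, rfl⟩)

/-- For a class `F` closed under submodules, the modules without nonzero maps from `F` are
cogenerated by an injective one. -/
theorem exists_injective_cogenerating_orthogonal [Small.{v} A]
    (F : ObjectProperty (ModuleCat.{v} A))
    (hF : ∀ Y, F Y → ∀ S : Submodule A Y, F (ModuleCat.of A S)) :
    ∃ E : ModuleCat.{v} A, Module.Injective A E ∧ (∀ Y, F Y → ∀ f : Y →ₗ[A] E, f = 0) ∧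
      ∀ M : ModuleCat.{v} A, (∀ Y, F Y → ∀ f : Y →ₗ[A] M, f = 0) → IsCogeneratedBy A E M := by
  -- Cyclic modules suffice to test points and form a set; `Shrink` places them in universe `v`.
  let ι := {I : Submodule A (Shrink.{v} A) //
    ∀ Y, F Y → ∀ f : Y →ₗ[A] (Shrink.{v} A ⧸ I), f = 0}
  choose H hH i hi hess using fun I : ι =>
    exists_essential_injective_embedding (A := A) (Shrink.{v} A ⧸ I.1)
  have horth : ∀ I Y, F Y → ∀ f : Y →ₗ[A] H I, f = 0 := by
    intro I Y hY f
    -- The part of Y mapped into the cyclic module is again in F, so f kills it; essentiality of the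
    -- hull then gives f = 0.
    let S := (LinearMap.range (i I)).comap f
    have hz : ∀ y ∈ S, f y = 0 := by
      intro y hy
      let e := LinearEquiv.ofInjective (i I) (hi I)
      have := I.2 _ (hF Y hY S) (e.symm.toLinearMap ∘ₗ
        (f ∘ₗ S.subtype).codRestrict (LinearMap.range (i I)) fun y => y.2)
      have := LinearMap.congr_fun this ⟨y, hy⟩
      have := (LinearEquiv.map_eq_zero_iff e.symm).1 this
      exact congrArg Subtype.val this
    have := hess I (LinearMap.range f) (by
      rw [Submodule.eq_bot_iff]
      rintro _ ⟨⟨y, rfl⟩, hy⟩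
      exact hz y hy)
    exact LinearMap.range_eq_bot.1 this
  have := hH
  refine ⟨ModuleCat.of A (∀ I, H I), Module.Injective.pi A fun I => H I, fun Y hY f => ?_,
    fun M hM m hm => ?_⟩
  · refine LinearMap.ext fun y => funext fun I => ?_
    exact LinearMap.congr_fun (horth I Y hY (LinearMap.proj I ∘ₗ f)) y
  · let s : Shrink.{v} A →ₗ[A] M :=
      LinearMap.toSpanSingleton A M m ∘ₗ (Shrink.linearEquiv A A).toLinearMap
    let j : (Shrink.{v} A ⧸ LinearMap.ker s) →ₗ[A] M := (LinearMap.ker s).liftQ s le_rfl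
    have hj : Function.Injective j :=
      LinearMap.ker_eq_bot.1 (Submodule.ker_liftQ_eq_bot _ _ _ le_rfl)
    let I : ι := ⟨LinearMap.ker s, fun Y hY f => by
      have := hM Y hY (j ∘ₗ f)
      ext y
      exact hj (by simpa using LinearMap.congr_fun this y)⟩
    obtain ⟨h, hh⟩ := (hH I).out j hj (i I)
    let w := (LinearMap.ker s).mkQ ((Shrink.linearEquiv A A).symm 1)
    have hw : j w = m := by simp [j, w, s]
    refine ⟨(LinearMap.single A (fun I => H I) I) ∘ₗ h, fun h0 => hm ?_⟩
    have h1 : h m = 0 := by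
      have := congrFun h0 I
      rwa [LinearMap.comp_apply, LinearMap.single_apply, Pi.single_eq_same] at this
    rw [← hw, hh] at h1
    rw [← hw, (map_eq_zero_iff _ (hi I)).1 h1, map_zero]

end Injective

/-! ### Vanishing of Ext¹ as a lifting property -/

section Ext

variable {A : Type u} [Ring A]

theorem exists_lift_of_mem_range {M E X : Type*} [AddCommGroup M] [Module A M] [AddCommGroup E]
    [Module A E] [AddCommGroup X] [Module A X] (i : M →ₗ[A] E) (hi : Function.Injective i)
    (f : X →ₗ[A] E) (hf : ∀ x, f x ∈ LinearMap.range i) :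
    ∃ g : X →ₗ[A] M, ∀ x, i (g x) = f x :=
  ⟨(LinearEquiv.ofInjective i hi).symm.toLinearMap ∘ₗ f.codRestrict (LinearMap.range i) hf,
    fun x => congrArg Subtype.val ((LinearEquiv.ofInjective i hi).apply_symm_apply ⟨f x, hf x⟩)⟩

theorem exists_factor_of_surjective {P W Q : Type*} [AddCommGroup P] [Module A P]
    [AddCommGroup W] [Module A W] [AddCommGroup Q] [Module A Q] (p : P →ₗ[A] W)
    (hp : Function.Surjective p) (h : P →ₗ[A] Q) (hker : LinearMap.ker p ≤ LinearMap.ker h) :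
    ∃ h' : W →ₗ[A] Q, ∀ x, h' (p x) = h x :=
  ⟨(LinearMap.ker p).liftQ h hker ∘ₗ (p.quotKerEquivOfSurjective hp).symm.toLinearMap, fun x => by
    have : (p.quotKerEquivOfSurjective hp).symm (p x) = Submodule.Quotient.mk x := by
      rw [LinearEquiv.symm_apply_eq]; rfl
    simp only [LinearMap.comp_apply, LinearEquiv.coe_coe, this]
    rfl⟩

/-- If `X` admits a splitting of the pullback along `h : X → Z` of `0 → M → E → Z`, then `h` lifts
to `E`. -/
theorem exists_lift_of_pullback {E X Z M : Type*} [AddCommGroup E] [Module A E] [AddCommGroup X]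
    [Module A X] [AddCommGroup Z] [Module A Z] [AddCommGroup M] [Module A M]
    (i : M →ₗ[A] E) (q : E →ₗ[A] Z) (hi : Function.Injective i) (hiq : Function.Exact i q)
    (h : X →ₗ[A] Z) (hq : ∀ x, ∃ e, q e = h x)
    (hext : ∀ (p : (q.coprod (-h)).ker →ₗ[A] X), Function.Surjective p →
      ∀ f : LinearMap.ker p →ₗ[A] M, Function.Injective f →
        ∃ g : (q.coprod (-h)).ker →ₗ[A] M, ∀ y : LinearMap.ker p, g y = f y) :
    ∃ k : X →ₗ[A] E, q ∘ₗ k = h := by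
  let Y := (q.coprod (-h)).ker
  have hY : ∀ y : Y, q y.1.1 = h y.1.2 := fun y => by
    have := LinearMap.mem_ker.1 y.2
    rwa [LinearMap.coprod_apply, LinearMap.neg_apply, ← sub_eq_add_neg, sub_eq_zero] at this
  let p : Y →ₗ[A] X := LinearMap.snd A E X ∘ₗ Y.subtype
  have hp : Function.Surjective p := fun x => by
    obtain ⟨e, he⟩ := hq x
    exact ⟨⟨(e, x), by simp [Y, he]⟩, rfl⟩
  let a : Y →ₗ[A] E := LinearMap.fst A E X ∘ₗ Y.subtype
  obtain ⟨f, hf⟩ := exists_lift_of_mem_range i hi (a ∘ₗ (LinearMap.ker p).subtype)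
    fun (y : LinearMap.ker p) => by
    refine (hiq _).1 ?_
    change q y.1.1.1 = 0
    rw [hY]
    have : y.1.1.2 = 0 := y.2
    rw [this, map_zero]
  obtain ⟨g, hg⟩ := hext p hp f fun y z hyz => by
    refine Subtype.ext (Subtype.ext (Prod.ext ?_ ?_))
    · exact (hf y).symm.trans ((congrArg i hyz).trans (hf z))
    · exact (LinearMap.mem_ker.1 y.2).trans (LinearMap.mem_ker.1 z.2).symm
  have hker : LinearMap.ker p ≤ LinearMap.ker (a - i ∘ₗ g) := fun y hy => by
    have := hg ⟨y, hy⟩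
    have h2 : i (g y) = a y := (congrArg i this).trans (hf _)
    simp [h2]
  obtain ⟨k, hk⟩ := exists_factor_of_surjective p hp _ hker
  refine ⟨k, ?_⟩
  ext x
  obtain ⟨y, rfl⟩ := hp x
  rw [LinearMap.comp_apply, hk]
  change q (a y - i (g y)) = h y.1.2
  rw [map_sub, (hiq _).2 ⟨_, rfl⟩, sub_zero]
  exact hY y

theorem ExtVanishes.exists_lift {E X Z : Type v} {M : Type*} [AddCommGroup E] [Module A E]
    [AddCommGroup X] [Module A X] [AddCommGroup Z] [Module A Z] [AddCommGroup M] [Module A M]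
    (hX : ExtVanishes.{u, v} A M X)
    (i : M →ₗ[A] E) (q : E →ₗ[A] Z) (hi : Function.Injective i) (hiq : Function.Exact i q)
    (h : X →ₗ[A] Z) (hq : ∀ x, ∃ e, q e = h x) : ∃ k : X →ₗ[A] E, q ∘ₗ k = h :=
  exists_lift_of_pullback i q hi hiq h hq fun p hp f _ => hX _ p hp f

/-- A map `f : ker p → M` extends along the inclusion if its composition with `i : M → E` does,
provided that all maps `X → Z` lift along `q`. -/
theorem exists_extension_of_lift {E X Y Z M : Type*} [AddCommGroup E] [Module A E]
    [AddCommGroup X] [Module A X] [AddCommGroup Y] [Module A Y] [AddCommGroup Z] [Module A Z]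
    [AddCommGroup M] [Module A M]
    (i : M →ₗ[A] E) (q : E →ₗ[A] Z) (hi : Function.Injective i) (hiq : Function.Exact i q)
    (hlift : ∀ h : X →ₗ[A] Z, ∃ k : X →ₗ[A] E, q ∘ₗ k = h)
    (p : Y →ₗ[A] X) (hp : Function.Surjective p) (f : LinearMap.ker p →ₗ[A] M)
    (t : Y →ₗ[A] E) (ht : ∀ y : LinearMap.ker p, t y = i (f y)) :
    ∃ g : Y →ₗ[A] M, ∀ y : LinearMap.ker p, g y = f y := by
  have hker : LinearMap.ker p ≤ LinearMap.ker (q ∘ₗ t) := fun y hy => by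
    have := ht ⟨y, hy⟩
    simp only at this
    simp [this, (hiq _).2 ⟨_, rfl⟩]
  obtain ⟨h, hh⟩ := exists_factor_of_surjective p hp _ hker
  obtain ⟨k, hk⟩ := hlift h
  obtain ⟨g, hg⟩ := exists_lift_of_mem_range i hi (t - k ∘ₗ p) fun y => by
    refine (hiq _).1 ?_
    have := LinearMap.congr_fun hk (p y)
    rw [hh, LinearMap.comp_apply] at this
    simp [this]
  refine ⟨g, fun y => hi ?_⟩
  have : p y = 0 := y.2
  simp [hg, ht, this]

/-- Injectivity of E extends f to a map Y → E; subtracting a lift of the map it induces X → Z brings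
it back into M. -/
theorem extVanishes_of_lift {E : Type v} {X Z M : Type*} [AddCommGroup E] [Module A E]
    [AddCommGroup X] [Module A X] [AddCommGroup Z] [Module A Z] [AddCommGroup M] [Module A M]
    [Small.{v} A] (hE : Module.Injective A E) (i : M →ₗ[A] E) (q : E →ₗ[A] Z)
    (hi : Function.Injective i) (hiq : Function.Exact i q)
    (hlift : ∀ h : X →ₗ[A] Z, ∃ k : X →ₗ[A] E, q ∘ₗ k = h) :
    ExtVanishes.{u, v} A M X := fun Y _ _ p hp f => by
  obtain ⟨t, ht⟩ := Module.Injective.extension_property A E _ _ (LinearMap.ker p).subtype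
    (LinearMap.ker p).subtype_injective (i ∘ₗ f)
  exact exists_extension_of_lift i q hi hiq hlift p hp f t fun y => LinearMap.congr_fun ht y

/-- Both directions are long exact sequences. For the converse, a class comes from a map X → E/C
with E injective, and that map lifts to E. -/
theorem kerExtOne_iff [Small.{v} A] {C X : ModuleCat.{v} A} :
    KerExtOne C X ↔ ExtVanishes.{u, v} A C X := by
  constructor
  · intro hX Y _ _ p hp f
    have : Subsingleton (Abelian.Ext.{v} X C 1) := hX
    have hS := LinearMap.shortExact_shortComplexKer hp
    obtain ⟨x, hx⟩ := Abelian.Ext.contravariant_sequence_exact₁ hS C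
      (Abelian.Ext.mk₀ (ModuleCat.ofHom f)) (zero_add 1 : 1 + 0 = 1) (this.elim _ _)
    obtain ⟨g, rfl⟩ := Abelian.Ext.addEquiv₀.symm.surjective x
    have hg := (Abelian.Ext.mk₀_bijective _ _).1 ((Abelian.Ext.mk₀_comp_mk₀ _ g).symm.trans hx)
    exact ⟨g.hom, fun y => LinearMap.congr_fun (congrArg ModuleCat.Hom.hom hg) y⟩
  · intro hX
    obtain ⟨E, hE, i, hi⟩ := exists_injective_embedding (A := A) C
    have hS : (ShortComplex.mk (ModuleCat.ofHom i) (ModuleCat.ofHom (LinearMap.range i).mkQ)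
        (by ext x; simp)).ShortExact := by
      refine ModuleCat.shortComplex_shortExact _ ?_ hi (Submodule.mkQ_surjective _)
      exact LinearMap.exact_map_mkQ_range i
    refine subsingleton_of_forall_eq 0 fun e => ?_
    have : CategoryTheory.Injective E := Module.injective_object_of_injective_module A E
    obtain ⟨x, rfl⟩ := Abelian.Ext.covariant_sequence_exact₁ X hS e
      (Abelian.Ext.eq_zero_of_injective _) (zero_add 1)
    obtain ⟨h, rfl⟩ := Abelian.Ext.addEquiv₀.symm.surjective x
    obtain ⟨k, hk⟩ := hX.exists_lift i (LinearMap.range i).mkQ hi (LinearMap.exact_map_mkQ_range i)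
      h.hom fun x => Submodule.mkQ_surjective _ _
    have hk' : h = ModuleCat.ofHom k ≫ ModuleCat.ofHom (LinearMap.range i).mkQ :=
      ModuleCat.hom_ext hk.symm
    rw [Abelian.Ext.addEquiv₀_symm_apply, hk', ← Abelian.Ext.mk₀_comp_mk₀]
    have h0 := hS.comp_extClass
    rw [Abelian.Ext.comp_assoc_of_second_deg_zero, h0, Abelian.Ext.comp_zero]

end Ext

/-! ### Modules over a quotient ring as annihilated `A`-modules -/

section Quotient

variable {A : Type u} [Ring A] (I : Ideal A)

/-- Maps `N → M` extend to `Y` for each short exact sequence `0 → N → Y → X → 0` of modules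
annihilated by `I`. -/
def ExtVanishesModulo (M X : Type*) [AddCommGroup M] [Module A M] [AddCommGroup X] [Module A X] :
    Prop :=
  ∀ (Y : Type v) [AddCommGroup Y] [Module A Y], (∀ a ∈ I, ∀ y : Y, a • y = 0) →
    ∀ p : Y →ₗ[A] X, Function.Surjective p →
    ∀ f : LinearMap.ker p →ₗ[A] M, ∃ g : Y →ₗ[A] M, ∀ y : LinearMap.ker p, g y = f y

variable {I} [I.IsTwoSided]

section

variable {C X Y : Type*} [AddCommGroup C] [Module A C] [Module (A ⧸ I) C]
  [IsScalarTower A (A ⧸ I) C] [AddCommGroup X] [Module A X] [Module (A ⧸ I) X]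
  [IsScalarTower A (A ⧸ I) X]

theorem mk_smul_eq_smul (a : A) (x : X) : (Ideal.Quotient.mk I a) • x = a • x := by
  have : Ideal.Quotient.mk I a = a • (1 : A ⧸ I) := by
    rw [← map_one (Ideal.Quotient.mk I)]
    exact congrArg (Ideal.Quotient.mk I) (mul_one a).symm
  rw [this, smul_assoc, one_smul]

/-- An `A`-linear map between `A ⧸ I`-modules is `A ⧸ I`-linear. -/
def extendQuotient (f : X →ₗ[A] C) : X →ₗ[A ⧸ I] C where
  toFun := f
  map_add' := map_add f
  map_smul' b x := by
    obtain ⟨a, rfl⟩ := Ideal.Quotient.mk_surjective b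
    simp [mk_smul_eq_smul]

theorem isCogeneratedBy_quotient_iff :
    IsCogeneratedBy (A ⧸ I) C X ↔ IsCogeneratedBy A C X :=
  ⟨fun h x hx => (h x hx).imp' (LinearMap.restrictScalars A) fun _ hf => hf,
    fun h x hx => (h x hx).imp' extendQuotient fun _ hf => hf⟩

theorem extVanishes_quotient_iff :
    ExtVanishes.{u, v} (A ⧸ I) C X ↔ ExtVanishesModulo.{u, v} I C X := by
  constructor
  · intro h Y _ _ hY p hp f
    have hY' : Module.IsTorsionBySet A Y I := fun y a => hY a a.2 y
    let := hY'.module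
    have : IsScalarTower A (A ⧸ I) Y := hY'.isScalarTower
    obtain ⟨g, hg⟩ := h Y (extendQuotient p) hp
      { toFun := fun y => f ⟨y.1, y.2⟩
        map_add' := fun y z => map_add f ⟨y.1, y.2⟩ ⟨z.1, z.2⟩
        map_smul' := fun b y => by
          obtain ⟨a, rfl⟩ := Ideal.Quotient.mk_surjective b
          exact (congrArg f (Subtype.ext (mk_smul_eq_smul a y.1))).trans
            ((map_smul f a ⟨y.1, y.2⟩).trans (mk_smul_eq_smul a (f _)).symm) }
    exact ⟨g.restrictScalars A, fun y => hg ⟨y.1, y.2⟩⟩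
  · intro h Y _ _ p hp f
    let : Module A Y := Module.compHom Y (Ideal.Quotient.mk I)
    have hmk : ∀ (a : A) (y : Y), a • y = Ideal.Quotient.mk I a • y := fun _ _ => rfl
    have : IsScalarTower A (A ⧸ I) Y := ⟨fun a b y => by
      obtain ⟨b, rfl⟩ := Ideal.Quotient.mk_surjective b
      rw [hmk, smul_smul]
      rfl⟩
    obtain ⟨g, hg⟩ := h Y (fun a ha y => by
      rw [hmk, Ideal.Quotient.eq_zero_iff_mem.2 ha, zero_smul]) (p.restrictScalars A) hp
      { toFun := fun y => f ⟨y.1, y.2⟩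
        map_add' := fun y z => map_add f ⟨y.1, y.2⟩ ⟨z.1, z.2⟩
        map_smul' := fun a y => by
          rw [RingHom.id_apply, ← mk_smul_eq_smul (I := I) a (f _), ← map_smul]
          rfl }
    exact ⟨extendQuotient g, fun y => hg ⟨y.1, y.2⟩⟩

end

/-- This removes the quotient ring from the cotilting condition, so that the main arguments stay
over `A`. -/
theorem isCotilting_quotient_iff [Small.{v} A] (C : Type v) [AddCommGroup C] [Module A C]
    [Module (A ⧸ I) C] [IsScalarTower A (A ⧸ I) C] :
    IsCotilting (ModuleCat.of (A ⧸ I) C) ↔ ∀ (X : Type v) [AddCommGroup X] [Module A X],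
      (∀ a ∈ I, ∀ x : X, a • x = 0) →
        (IsCogeneratedBy A C X ↔ ExtVanishesModulo.{u, v} I C X) := by
  constructor
  · intro h X _ _ hX
    have hX' : Module.IsTorsionBySet A X I := fun x a => hX a a.2 x
    let := hX'.module
    have : IsScalarTower A (A ⧸ I) X := hX'.isScalarTower
    rw [← isCogeneratedBy_quotient_iff (I := I), ← extVanishes_quotient_iff]
    have := congrFun h (ModuleCat.of (A ⧸ I) X)
    exact (cogen_iff.symm.trans (iff_of_eq this)).trans kerExtOne_iff
  · intro h
    funext X
    let : Module A X := Module.compHom X (Ideal.Quotient.mk I)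
    have hmk : ∀ (a : A) (x : X), a • x = Ideal.Quotient.mk I a • x := fun _ _ => rfl
    have : IsScalarTower A (A ⧸ I) X := ⟨fun a b x => by
      obtain ⟨b, rfl⟩ := Ideal.Quotient.mk_surjective b
      rw [hmk, smul_smul]
      rfl⟩
    refine propext (cogen_iff.trans (Iff.trans ?_ kerExtOne_iff.symm))
    refine (isCogeneratedBy_quotient_iff (I := I)).trans
      ((h X fun a ha x => ?_).trans extVanishes_quotient_iff.symm)
    rw [hmk, Ideal.Quotient.eq_zero_iff_mem.2 ha, zero_smul]

end Quotient

theorem isCotilting_overQuotientAnn_iff {A : Type u} [Ring A] [Small.{v} A]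
    {C : ModuleCat.{v} A} :
    IsCotilting (overQuotientAnn C) ↔ ∀ (X : Type v) [AddCommGroup X] [Module A X],
      (∀ a ∈ Module.annihilator A C, ∀ x : X, a • x = 0) →
        (IsCogeneratedBy A C X ↔ ExtVanishesModulo.{u, v} (Module.annihilator A C) C X) := by
  let : Module (A ⧸ Module.annihilator A C) C := Module.quotientAnnihilator
  have : IsScalarTower A (A ⧸ Module.annihilator A C) C :=
    (Module.isTorsionBySet_annihilator A C).isScalarTower
  exact isCotilting_quotient_iff (I := Module.annihilator A C) C

/-! ### Lifting along injective copresentations -/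

section Lifting

variable {A : Type u} [Ring A]

theorem exists_factor_of_injective [Small.{v} A] {Q : Type v} {P W : Type*} [AddCommGroup Q] [Module A Q]
    [AddCommGroup P] [Module A P] [AddCommGroup W] [Module A W] (hQ : Module.Injective A Q)
    (g : P →ₗ[A] W) (h : P →ₗ[A] Q) (hker : LinearMap.ker g ≤ LinearMap.ker h) :
    ∃ h' : W →ₗ[A] Q, ∀ x, h' (g x) = h x := by
  obtain ⟨h', hh'⟩ := Module.Injective.extension_property A Q _ _
    ((LinearMap.ker g).liftQ g le_rfl)
    (LinearMap.ker_eq_bot.1 (Submodule.ker_liftQ_eq_bot _ _ _ le_rfl))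
    ((LinearMap.ker g).liftQ h hker)
  exact ⟨h', fun x => LinearMap.congr_fun hh' (Submodule.Quotient.mk x)⟩

theorem isCoseparator_iff {E : ModuleCat.{v} A} :
    IsCoseparator E ↔ ∀ M : ModuleCat.{v} A, IsCogeneratedBy A E M := by
  rw [isCoseparator_def]
  constructor
  · intro h M m hm
    by_contra! hf
    have := h (ModuleCat.ofHom (Submodule.span A {m}).subtype)
      (0 : ModuleCat.of A (Submodule.span A {m}) ⟶ M) fun f => by
        ext ⟨x, hx⟩
        obtain ⟨a, rfl⟩ := Submodule.mem_span_singleton.1 hx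
        simp [hf]
    exact hm (LinearMap.congr_fun (congrArg ModuleCat.Hom.hom this)
      ⟨m, Submodule.mem_span_singleton_self m⟩)
  · intro h X Y f g hfg
    ext x
    by_contra hx
    obtain ⟨k, hk⟩ := h Y _ (sub_ne_zero.2 hx)
    refine hk ?_
    rw [map_sub, sub_eq_zero]
    exact LinearMap.congr_fun (congrArg ModuleCat.Hom.hom (hfg (ModuleCat.ofHom k))) x

theorem exists_isInjectiveCogenerator (A : Type u) [Ring A] [Small.{v} A] :
    ∃ E : ModuleCat.{v} A, IsInjectiveCogenerator E := by
  obtain ⟨E, hE, -, h⟩ := exists_injective_cogenerating_orthogonal (A := A) (fun _ => False)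
    fun _ h _ => h
  exact ⟨E, hE, isCoseparator_iff.2 fun M => h M fun _ h => h.elim⟩

/-- An embedding into an injective module extends to an injective copresentation with essential
image. -/
theorem exists_essential_copresentation [Small.{v} A] {M : Type*} {K : Type v} [AddCommGroup M] [Module A M]
    [AddCommGroup K] [Module A K] (i : M →ₗ[A] K) :
    ∃ (H : ModuleCat.{v} A) (β : K →ₗ[A] H), Module.Injective A H ∧ Function.Exact i β ∧
      ∀ S : Submodule A H, S ⊓ LinearMap.range β = ⊥ → S = ⊥ := by
  obtain ⟨H, hH, j, hj, hess⟩ :=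
    exists_essential_injective_embedding (A := A) (K ⧸ LinearMap.range i)
  refine ⟨H, j ∘ₗ (LinearMap.range i).mkQ, hH, fun x => ?_, fun S hS => hess S ?_⟩
  · rw [LinearMap.comp_apply, map_eq_zero_iff j hj, Submodule.mkQ_apply,
      Submodule.Quotient.mk_eq_zero]
    rfl
  · rwa [LinearMap.range_comp_of_range_eq_top _ (Submodule.range_mkQ _)] at hS

/-- Maps lift along an injective copresentation of `M` with essential image if `Ext¹(-, M)`
vanishes on all submodules of the source. -/
theorem exists_lift_of_essential {M K H X : Type v} [AddCommGroup M] [Module A M]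
    [AddCommGroup K] [Module A K] [AddCommGroup H] [Module A H] [AddCommGroup X] [Module A X]
    (hK : Module.Injective A K) (i : M →ₗ[A] K) (hi : Function.Injective i) (β : K →ₗ[A] H)
    (hiβ : Function.Exact i β) (hess : ∀ S : Submodule A H, S ⊓ LinearMap.range β = ⊥ → S = ⊥)
    (hX : ∀ S : Submodule A X, ExtVanishes.{u, v} A M S) (h : X →ₗ[A] H) :
    ∃ k : X →ₗ[A] K, β ∘ₗ k = h := by
  -- A lift exists on the preimage of the image of β. Once it is extended to X, the error has image
  -- meeting that of β trivially, hence is zero.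
  let S := (LinearMap.range β).comap h
  obtain ⟨k, hk⟩ := (hX S).exists_lift i β hi hiβ (h ∘ₗ S.subtype) fun x => x.2
  obtain ⟨k', hk'⟩ := hK.out S.subtype S.subtype_injective k
  have hS : ∀ x ∈ S, h x = β (k' x) := fun x hx => by
    have h1 := hk' ⟨x, hx⟩
    have h2 := LinearMap.congr_fun hk ⟨x, hx⟩
    simp only [LinearMap.comp_apply, Submodule.subtype_apply] at h1 h2
    rw [h1, h2]
  have h0 : LinearMap.range (h - β ∘ₗ k') = ⊥ := hess _ (by
    rw [Submodule.eq_bot_iff]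
    rintro _ ⟨⟨x, rfl⟩, y, hy⟩
    have hx : x ∈ S := ⟨y + k' x, by simp [hy]⟩
    simp [hS x hx])
  exact ⟨k', (sub_eq_zero.1 (LinearMap.range_eq_bot.1 h0)).symm⟩

/-- If `M` is a retract of `N` and all maps from `X` lift along some injective copresentation
of `N`, then they lift along each injective copresentation of `M` with essential image. -/
theorem exists_lift_of_retract [Small.{v} A] {M K H N L₀ L₁ X : Type v} [AddCommGroup M] [Module A M]
    [AddCommGroup K] [Module A K] [AddCommGroup H] [Module A H] [AddCommGroup N] [Module A N]
    [AddCommGroup L₀] [Module A L₀] [AddCommGroup L₁] [Module A L₁] [AddCommGroup X] [Module A X]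
    (hK : Module.Injective A K) (hH : Module.Injective A H) (i : M →ₗ[A] K)
    (hi : Function.Injective i) (β : K →ₗ[A] H) (hiβ : Function.Exact i β)
    (hess : ∀ S : Submodule A H, S ⊓ LinearMap.range β = ⊥ → S = ⊥)
    (hL₀ : Module.Injective A L₀) (hL₁ : Module.Injective A L₁) (i' : N →ₗ[A] L₀)
    (hi' : Function.Injective i') (γ : L₀ →ₗ[A] L₁) (hiγ : Function.Exact i' γ)
    (s : M →ₗ[A] N) (r : N →ₗ[A] M) (hrs : ∀ x, r (s x) = x)
    (hX : ∀ h : X →ₗ[A] L₁, ∃ k : X →ₗ[A] L₀, γ ∘ₗ k = h) (h : X →ₗ[A] H) :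
    ∃ k : X →ₗ[A] K, β ∘ₗ k = h := by
  -- The maps s and r extend to morphisms (a, b) and (a', b') of copresentations, whose composite is
  -- the identity on M and so differs from the identity by a homotopy t.
  obtain ⟨a, ha⟩ := hL₀.out i hi (i' ∘ₗ s)
  obtain ⟨a', ha'⟩ := hK.out i' hi' (i ∘ₗ r)
  simp only [LinearMap.comp_apply] at ha ha'
  obtain ⟨b, hb⟩ := exists_factor_of_injective hL₁ β (γ ∘ₗ a) fun x hx => by
    obtain ⟨m, rfl⟩ := (hiβ x).1 hx
    simpa [ha] using (hiγ _).2 ⟨_, rfl⟩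
  obtain ⟨b', hb'⟩ := exists_factor_of_injective hH γ (β ∘ₗ a') fun x hx => by
    obtain ⟨m, rfl⟩ := (hiγ x).1 hx
    simpa [ha'] using (hiβ _).2 ⟨_, rfl⟩
  obtain ⟨t, ht⟩ := exists_factor_of_injective hK β (a' ∘ₗ a - LinearMap.id) fun x hx => by
    obtain ⟨m, rfl⟩ := (hiβ x).1 hx
    simp [ha, ha', hrs]
  simp only [LinearMap.comp_apply] at hb hb'
  -- Since w fixes the image of β, essentiality makes it injective, and likewise its left inverse
  -- w'; so w is invertible.
  let w : H →ₗ[A] H := b' ∘ₗ b - β ∘ₗ t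
  have hw : ∀ x, w (β x) = β x := fun x => by
    simp [w, hb, hb', ht]
  have hwinj : Function.Injective w := by
    rw [← LinearMap.ker_eq_bot]
    refine hess _ ((Submodule.eq_bot_iff _).2 ?_)
    rintro _ ⟨hx, x, rfl⟩
    rw [← hw]
    exact hx
  obtain ⟨w', hw'⟩ := hH.out w hwinj LinearMap.id
  simp only [LinearMap.id_apply] at hw'
  have hw'inj : Function.Injective w' := by
    rw [← LinearMap.ker_eq_bot]
    refine hess _ ((Submodule.eq_bot_iff _).2 ?_)
    rintro _ ⟨hx, x, rfl⟩
    have h1 := hw' (β x)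
    rw [hw] at h1
    exact h1.symm.trans hx
  have hww' : ∀ z, w (w' z) = z := fun z => hw'inj (hw' _)
  obtain ⟨k, hk⟩ := hX (b ∘ₗ w' ∘ₗ h)
  refine ⟨a' ∘ₗ k - t ∘ₗ w' ∘ₗ h, ?_⟩
  ext x
  have h1 : γ (k x) = b (w' (h x)) := LinearMap.congr_fun hk x
  have h2 := hww' (h x)
  simp only [w, LinearMap.sub_apply, LinearMap.comp_apply] at h2
  rw [← h1, hb'] at h2
  simpa using h2

end Lifting

/-! ### From cosilting to torsionfree and cotilting -/

section Implications

variable {A : Type u} [Ring A]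

theorem cogenClosedUnderExtensions_of_extVanishes {C : Type v} [AddCommGroup C] [Module A C]
    (h : ∀ (X : Type v) [AddCommGroup X] [Module A X], IsCogeneratedBy A C X →
      ExtVanishes.{u, v} A C X) : CogenClosedUnderExtensions A C :=
  fun _ _ _ _ _ _ p hX hker => hX.of_extension p hker (h _ (hX.submodule _))

theorem isCogeneratedBy_quotient_annihilator (C : Type*) [AddCommGroup C] [Module A C] :
    IsCogeneratedBy A C (A ⧸ Module.annihilator A C) := fun b hb => by
  obtain ⟨a, rfl⟩ := Submodule.mkQ_surjective _ b
  have ha : a ∉ Module.annihilator A C := fun h => hb ((Submodule.Quotient.mk_eq_zero _).2 h)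
  rw [Module.mem_annihilator] at ha
  push Not at ha
  obtain ⟨c, hc⟩ := ha
  exact ⟨Submodule.liftQ _ (LinearMap.toSpanSingleton A C c) fun x hx => by
    simpa using Module.mem_annihilator.1 hx c, hc⟩

/-- Every module annihilated by `Ann C` is a quotient of a module cogenerated by `C`. -/
theorem exists_surjective_of_annihilated [Small.{v} A] (C : Type*) {X : Type v} [AddCommGroup C]
    [Module A C] [AddCommGroup X] [Module A X]
    (hX : ∀ a ∈ Module.annihilator A C, ∀ x : X, a • x = 0) :
    ∃ P : ModuleCat.{v} A, IsCogeneratedBy A C P ∧ ∃ p : P →ₗ[A] X, Function.Surjective p := by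
  let B := A ⧸ Module.annihilator A C
  let e := Shrink.linearEquiv.{v} A B
  have hB : IsCogeneratedBy A C (Shrink.{v} B) :=
    (isCogeneratedBy_quotient_annihilator C).of_injective e.toLinearMap e.injective
  let q : X → Shrink.{v} B →ₗ[A] X := fun x =>
    Submodule.liftQ _ (LinearMap.toSpanSingleton A X x) (fun a ha => by simpa using hX a ha x) ∘ₗ
      e.toLinearMap
  refine ⟨ModuleCat.of A (X →₀ Shrink.{v} B), fun f hf => ?_, Finsupp.lsum ℕ q, fun x =>
    ⟨Finsupp.single x (e.symm (Submodule.mkQ _ 1)), ?_⟩⟩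
  · obtain ⟨x, hx⟩ := Finsupp.ne_iff.1 hf
    obtain ⟨g, hg⟩ := hB _ hx
    exact ⟨g ∘ₗ Finsupp.lapply x, hg⟩
  · rw [Finsupp.lsum_single]
    simp only [q, LinearMap.comp_apply, LinearEquiv.coe_coe, LinearEquiv.apply_symm_apply]
    exact one_smul A x

theorem isTorsionfreeClass_and_isCotilting [Small.{v} A] {C : ModuleCat.{v} A}
    (hC : IsCosilting C) :
    IsTorsionfreeClass (Cogen C) ∧ IsCotilting (overQuotientAnn C) := by
  obtain ⟨E₀, E₁, ι, ω, hι, hω⟩ := hC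
  have hω' : ∀ (X : Type v) [AddCommGroup X] [Module A X], IsCogeneratedBy A C X ↔
      ∀ h : X →ₗ[A] E₁, ∃ k : X →ₗ[A] E₀, ω ∘ₗ k = h := fun X _ _ =>
    cogen_iff.symm.trans (iff_of_eq (congrFun hω (ModuleCat.of A X)))
  have hext : ∀ (X : Type v) [AddCommGroup X] [Module A X], IsCogeneratedBy A C X →
      ExtVanishes.{u, v} A C X := fun X _ _ hX =>
    extVanishes_of_lift hι.injective_left ι ω hι.mono hι.exact ((hω' X).1 hX)
  refine ⟨isTorsionfreeClass_cogen (cogenClosedUnderExtensions_of_extVanishes hext),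
    isCotilting_overQuotientAnn_iff.2 fun X _ _ hX =>
      ⟨fun h Y _ _ _ p hp f => hext X h Y p hp f, fun h => (hω' X).2 fun f => ?_⟩⟩
  obtain ⟨P, hP, p, hp⟩ := exists_surjective_of_annihilated C hX
  obtain ⟨k, hk⟩ := (hω' P).1 hP (f ∘ₗ p)
  -- On ker p the lift k takes values in ker ω = C. Extending this restriction to P and subtracting
  -- it makes k descend to X.
  obtain ⟨f', hf'⟩ := exists_lift_of_mem_range ι hι.mono (k ∘ₗ (LinearMap.ker p).subtype)
    fun y => by
      refine (hι.exact _).1 ?_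
      have := LinearMap.congr_fun hk y
      rw [LinearMap.comp_apply, LinearMap.comp_apply, LinearMap.mem_ker.1 y.2, map_zero] at this
      exact this
  obtain ⟨g, hg⟩ := h P (fun a ha => hP.smul_eq_zero ha) p hp f'
  have hιg : ∀ y : LinearMap.ker p, ι (g y) = k y := fun y => by
    rw [hg, hf']
    rfl
  obtain ⟨t, ht⟩ := exists_factor_of_surjective p hp (k - ι ∘ₗ g) fun y hy => by
    have := hιg ⟨y, hy⟩
    simp only at this
    simp [this]
  refine ⟨t, ?_⟩
  ext x
  obtain ⟨y, rfl⟩ := hp x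
  have h1 := LinearMap.congr_fun hk y
  simp only [LinearMap.comp_apply] at h1
  rw [LinearMap.comp_apply, ht, LinearMap.sub_apply, LinearMap.comp_apply, map_sub, h1,
    (hι.exact _).2 ⟨_, rfl⟩, sub_zero]

end Implications

/-! ### From cotilting to an approximation -/

section

variable {A : Type u} [Ring A]

/-- The largest submodule of `X` annihilated by the two-sided ideal `I`. -/
def annihilatedSubmodule (I : Ideal A) [I.IsTwoSided] (X : Type*) [AddCommGroup X] [Module A X] :
    Submodule A X where
  carrier := {x | ∀ a ∈ I, a • x = 0}
  add_mem' hx hy a ha := by rw [smul_add, hx a ha, hy a ha, add_zero]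
  zero_mem' a _ := smul_zero a
  smul_mem' b x hx a ha := by rw [smul_smul]; exact hx _ (I.mul_mem_right b ha)

/-- A cotilting module over `A ⧸ Ann C` whose cogenerated class is torsionfree over `A` is
Ext-injective in that class. -/
theorem extVanishes_of_isCotilting [Small.{v} A] {C : ModuleCat.{v} A}
    (hT : IsTorsionfreeClass (Cogen C)) (hC : IsCotilting (overQuotientAnn C)) (X : Type v)
    [AddCommGroup X] [Module A X] (hX : IsCogeneratedBy A C X) : ExtVanishes.{u, v} A C X := by
  obtain ⟨K, hK, i, hi⟩ := exists_injective_embedding (A := A) C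
  refine extVanishes_of_lift hK i (LinearMap.range i).mkQ hi (LinearMap.exact_map_mkQ_range i)
    fun h => exists_lift_of_pullback i _ hi (LinearMap.exact_map_mkQ_range i) h
      (fun x => Submodule.mkQ_surjective _ _) fun p hp f hf => ?_
  -- Injectivity of f places ker p in `Cogen C`, so the extension is killed by Ann C and cotilting
  -- applies to it.
  have hY := hT.cogenClosedUnderExtensions _ _ p hX (IsCogeneratedBy.refl.of_injective f hf)
  exact (isCotilting_overQuotientAnn_iff.1 hC X fun a ha => hX.smul_eq_zero ha).1 hX _
    (fun a ha => hY.smul_eq_zero ha) p hp f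

theorem isExtInjective_and_exists_approximation [Small.{v} A] {C : ModuleCat.{v} A}
    (hT : IsTorsionfreeClass (Cogen C)) (hC : IsCotilting (overQuotientAnn C)) :
    IsExtInjective (Cogen C) C ∧ ∃ E : ModuleCat.{v} A, IsInjectiveCogenerator E ∧
      ∃ (C₁ C₀ : ModuleCat.{v} A) (i : C₁ →ₗ[A] C₀) (g : C₀ →ₗ[A] E),
        Function.Injective i ∧ Function.Exact i g ∧ ProdClass C C₁ ∧ ProdClass C C₀ ∧
          IsRightApproximation (Cogen C) g := by
  refine ⟨⟨cogen_iff.2 .refl, fun X hX => kerExtOne_iff.2 <|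
    extVanishes_of_isCotilting hT hC X (cogen_iff.1 hX)⟩, ?_⟩
  rw [isCotilting_overQuotientAnn_iff] at hC
  obtain ⟨E, hE⟩ := exists_isInjectiveCogenerator.{u, v} A
  refine ⟨E, hE, ?_⟩
  obtain ⟨L, hL, i₀, hi₀⟩ := exists_injective_embedding (A := A) C
  let K := annihilatedSubmodule (Module.annihilator A C) L
  let W := annihilatedSubmodule (Module.annihilator A C) E
  let ι : C →ₗ[A] K := i₀.codRestrict K fun c a ha => by
    rw [← map_smul, Module.mem_annihilator.1 ha, map_zero]
  have hι : Function.Injective ι := fun x y h => hi₀ (congrArg Subtype.val h)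
  let Q := K ⧸ LinearMap.range ι
  let q : K →ₗ[A] Q := (LinearMap.range ι).mkQ
  have hq : Function.Surjective q := Submodule.mkQ_surjective _
  have hιq : Function.Exact ι q := LinearMap.exact_map_mkQ_range ι
  have hKext : ∀ (Y Z : Type v) [AddCommGroup Y] [Module A Y] [AddCommGroup Z] [Module A Z],
      (∀ a ∈ Module.annihilator A C, ∀ z : Z, a • z = 0) → ∀ j : Y →ₗ[A] Z,
      Function.Injective j → ∀ f : Y →ₗ[A] K, ∃ f' : Z →ₗ[A] K, ∀ y, f' (j y) = f y := by
    intro Y Z _ _ _ _ hZ j hj f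
    obtain ⟨f', hf'⟩ := hL.out j hj (K.subtype ∘ₗ f)
    exact ⟨f'.codRestrict K fun z a ha => by rw [← map_smul, hZ a ha, map_zero],
      fun y => Subtype.ext (hf' y)⟩
  have hlift : ∀ (X : Type v) [AddCommGroup X] [Module A X], IsCogeneratedBy A C X →
      ∀ h : X →ₗ[A] Q, ∃ k : X →ₗ[A] K, q ∘ₗ k = h := by
    intro X _ _ hX h
    have hX' : ∀ a ∈ Module.annihilator A C, ∀ x : X, a • x = 0 := fun a ha => hX.smul_eq_zero ha
    refine exists_lift_of_pullback ι q hι hιq h (fun x => hq _) fun p hp f _ =>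
      (hC X hX').1 hX _ (fun a ha y => ?_) p hp f
    exact Subtype.ext (Prod.ext (Subtype.ext (y.1.1.2 a ha)) (hX' a ha _))
  -- P is the pullback of K^J → Q^J along the map W → Q^J with all homomorphisms as components. In
  -- this way every map W → Q lifts to K after pulling back to P.
  let J := W →ₗ[A] Q
  let P := ((LinearMap.pi fun j : J => q ∘ₗ LinearMap.proj j).coprod
    (-LinearMap.pi fun j : J => j) : (J → K) × W →ₗ[A] (J → Q)).ker
  have hPmem : ∀ x : (J → K) × W, x ∈ P ↔ ∀ j : J, q (x.1 j) = j x.2 := fun x => by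
    rw [LinearMap.mem_ker, LinearMap.coprod_apply, LinearMap.neg_apply, ← sub_eq_add_neg,
      sub_eq_zero, funext_iff]
    rfl
  have hPann : ∀ a ∈ Module.annihilator A C, ∀ x : P, a • x = 0 := fun a ha x =>
    Subtype.ext (Prod.ext (funext fun j => Subtype.ext ((x.1.1 j).2 a ha))
      (Subtype.ext (x.1.2.2 a ha)))
  let g' : P →ₗ[A] W := LinearMap.snd A (J → K) W ∘ₗ P.subtype
  have hg' : Function.Surjective g' := fun w => by
    choose k hk using fun j : J => hq (j w)
    exact ⟨⟨(k, w), (hPmem _).2 hk⟩, rfl⟩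
  let i : (J → C) →ₗ[A] P :=
    (LinearMap.inl A (J → K) W ∘ₗ LinearMap.pi fun j : J => ι ∘ₗ LinearMap.proj j).codRestrict P
      fun c => (hPmem _).2 fun j => by
        simpa using (hιq _).2 ⟨c j, rfl⟩
  have hi : Function.Injective i := fun c d h => by
    funext j
    exact hι (congrFun (congrArg (fun x : P => x.1.1) h) j)
  have hig' : Function.Exact i g' := fun x => by
    constructor
    · intro hx
      have hx' : x.1.2 = 0 := hx
      choose c hc using fun j : J => (hιq (x.1.1 j)).1 (by
        rw [(hPmem _).1 x.2, hx', map_zero])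
      exact ⟨c, Subtype.ext (Prod.ext (funext hc) hx'.symm)⟩
    · rintro ⟨c, rfl⟩
      rfl
  have hPlift : ∀ h : P →ₗ[A] Q, ∃ k : P →ₗ[A] K, q ∘ₗ k = h := by
    intro h
    obtain ⟨k, hk⟩ := hlift (J → C) (.pi J) (h ∘ₗ i)
    obtain ⟨k', hk'⟩ := hKext _ _ hPann i hi k
    -- After correction on C^J the map factors through W, so it is some j in J, and the j-th
    -- coordinate of P lifts it.
    obtain ⟨j, hj⟩ := exists_factor_of_surjective g' hg' (h - q ∘ₗ k') fun x hx => by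
      obtain ⟨c, rfl⟩ := (hig' x).1 hx
      have := LinearMap.congr_fun hk c
      simp only [LinearMap.comp_apply] at this
      simp [hk', this]
    refine ⟨k' + LinearMap.proj j ∘ₗ LinearMap.fst A (J → K) W ∘ₗ P.subtype, ?_⟩
    ext x
    have h1 : q (x.1.1 j) = j (g' x) := (hPmem _).1 x.2 j
    rw [hj] at h1
    simp [h1]
  have hP : IsCogeneratedBy A C P := by
    refine (hC P hPann).2 fun Y _ _ hY p hp f => ?_
    obtain ⟨t, ht⟩ := hKext _ _ hY (LinearMap.ker p).subtype (LinearMap.ker p).subtype_injective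
      (ι ∘ₗ f)
    exact exists_extension_of_lift ι q hι hιq hPlift p hp f t ht
  let g : P →ₗ[A] E := W.subtype ∘ₗ g'
  have hig : Function.Exact i g := fun x => by
    rw [← hig' x]
    exact ⟨fun h => Subtype.ext h, fun h => congrArg Subtype.val h⟩
  have happrox : ∀ (X : Type v) [AddCommGroup X] [Module A X], IsCogeneratedBy A C X →
      ∀ h : X →ₗ[A] E, ∃ k : X →ₗ[A] P, g ∘ₗ k = h := by
    intro X _ _ hX h
    let h' : X →ₗ[A] W := h.codRestrict W fun x a ha => by
      rw [← map_smul, hX.smul_eq_zero ha, map_zero]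
    choose k hk using fun j : J => hlift X hX (j ∘ₗ h')
    exact ⟨((LinearMap.pi k).prod h').codRestrict P fun x => (hPmem _).2 fun j =>
      LinearMap.congr_fun (hk j) x, rfl⟩
  refine ⟨ModuleCat.of A (J → C), ModuleCat.of A P, i, g, hi, hig, prodClass_pi C J, ?_,
    cogen_iff.2 hP, fun X hX h => happrox X (cogen_iff.1 hX) h⟩
  let e : P →ₗ[A] ((P →ₗ[A] C) → C) := LinearMap.pi fun f => f
  have he : Function.Injective e := by
    rw [injective_iff_map_eq_zero]
    intro x hx
    by_contra h0
    obtain ⟨f, hf⟩ := hP x h0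
    exact hf (congrFun hx f)
  obtain ⟨w, hw⟩ := hE.1.out e he g
  obtain ⟨w', hw'⟩ := happrox _ (.pi _) w
  obtain ⟨d, hd⟩ := exists_lift_of_mem_range i hi (LinearMap.id - w' ∘ₗ e) fun x => by
    refine (hig _).1 ?_
    have := LinearMap.congr_fun hw' (e x)
    rw [LinearMap.comp_apply, hw] at this
    simp [this]
  -- Each component of d is a map P → C, hence already a coordinate of e; so d factors through e,
  -- and e splits.
  let d' : ((P →ₗ[A] C) → C) →ₗ[A] (J → C) :=
    LinearMap.pi fun j => LinearMap.proj (LinearMap.proj j ∘ₗ d)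
  refine ProdClass.of_retraction (M := ModuleCat.of A P) (I := P →ₗ[A] C) e (w' + i ∘ₗ d')
    fun x => ?_
  have : d' (e x) = d x := rfl
  simp [this, hd]

/-! ### From an approximation to cosilting -/

theorem injective_prod {M N : Type v} [AddCommGroup M] [Module A M] [AddCommGroup N] [Module A N]
    (hM : Module.Injective A M) (hN : Module.Injective A N) : Module.Injective A (M × N) :=
  ⟨fun _ _ _ _ _ _ f hf g => by
    obtain ⟨h₁, hh₁⟩ := hM.out f hf (LinearMap.fst A M N ∘ₗ g)
    obtain ⟨h₂, hh₂⟩ := hN.out f hf (LinearMap.snd A M N ∘ₗ g)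
    exact ⟨h₁.prod h₂, fun x => Prod.ext (hh₁ x) (hh₂ x)⟩⟩

theorem isCosilting_of_approximation [Small.{v} A] {C : ModuleCat.{v} A}
    (hC : IsExtInjective (Cogen C) C) {E C₁ C₀ : ModuleCat.{v} A} (hE : IsInjectiveCogenerator E)
    (i : C₁ →ₗ[A] C₀) (g : C₀ →ₗ[A] E) (hi : Function.Injective i) (hig : Function.Exact i g)
    (hC₁ : ProdClass C C₁) (hC₀ : ProdClass C C₀) (hg : IsRightApproximation (Cogen C) g) :
    IsCosilting C := by
  have hext : ∀ (X : Type v) [AddCommGroup X] [Module A X], IsCogeneratedBy A C X →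
      ExtVanishes.{u, v} A C X := fun X _ _ hX =>
    kerExtOne_iff.1 (hC.2 (ModuleCat.of A X) (cogen_iff.2 hX))
  obtain ⟨I₀, hI₀, ι, hι⟩ := exists_injective_embedding (A := A) C
  obtain ⟨I₁, α, hI₁, hια, hα⟩ := exists_essential_copresentation ι
  obtain ⟨E', hE', horth, hcog⟩ := exists_injective_cogenerating_orthogonal (Cogen C)
    fun Y hY S => cogen_iff.2 ((cogen_iff.1 hY).submodule S)
  let ω : I₀ →ₗ[A] I₁ × E' := LinearMap.inl A I₁ E' ∘ₗ α
  have hιω : Function.Exact ι ω := fun x => by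
    rw [← hια x]
    simp [ω]
  refine ⟨I₀, ModuleCat.of A (I₁ × E'), ι, ω, ⟨hI₀, injective_prod hI₁ hE', hι, hιω⟩, ?_⟩
  funext X
  refine propext ⟨fun hX h => ?_, fun hX => cogen_iff.2 (.of_separates ?_ hC₀.isCogeneratedBy)⟩
  · obtain ⟨k, hk⟩ := exists_lift_of_essential hI₀ ι hι α hια hα
      (fun S => hext S ((cogen_iff.1 hX).submodule S)) (LinearMap.fst A I₁ E' ∘ₗ h)
    have h0 := horth X hX (LinearMap.snd A I₁ E' ∘ₗ h)
    exact ⟨k, LinearMap.ext fun x => Prod.ext (LinearMap.congr_fun hk x)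
      (LinearMap.congr_fun h0 x).symm⟩
  intro x hx
  obtain ⟨f, hf⟩ := isCoseparator_iff.1 hE.2 X x hx
  obtain ⟨K, hK, j, hj⟩ := exists_injective_embedding (A := A) C₀
  obtain ⟨H₀, β, hH₀, hjβ, hβ⟩ := exists_essential_copresentation j
  obtain ⟨g', hg'⟩ := hE.1.out j hj g
  -- This is the cone of g on copresentations. Its kernel is that of g on C₀, namely C₁.
  let ω₁ : K →ₗ[A] H₀ × E := β.prod g'
  obtain ⟨H, β₁, hH, hjβ₁, hβ₁⟩ := exists_essential_copresentation (j ∘ₗ i)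
  have hω₁ : ∀ y, ω₁ y = 0 ↔ β₁ y = 0 := fun y => by
    rw [hjβ₁ y]
    constructor
    · intro h
      obtain ⟨c, rfl⟩ := (hjβ y).1 (congrArg Prod.fst h)
      obtain ⟨c, rfl⟩ := (hig c).1 ((hg' c).symm.trans (congrArg Prod.snd h))
      exact ⟨c, rfl⟩
    · rintro ⟨c, rfl⟩
      exact Prod.ext ((hjβ _).2 ⟨_, rfl⟩) ((hg' _).trans ((hig _).2 ⟨c, rfl⟩))
  have hT := injective_prod hH₀ hE.1
  obtain ⟨t, ht⟩ := exists_factor_of_injective hT β₁ ω₁ fun y hy => (hω₁ y).2 hy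
  have htinj : Function.Injective t := by
    rw [← LinearMap.ker_eq_bot]
    refine hβ₁ _ ((Submodule.eq_bot_iff _).2 ?_)
    rintro _ ⟨hy, y, rfl⟩
    exact (hω₁ y).1 ((ht y).symm.trans hy)
  obtain ⟨ρ, hρ⟩ := hH.out t htinj LinearMap.id
  have hρω : ∀ y, ρ (ω₁ y) = β₁ y := fun y => by rw [← ht, hρ]; rfl
  -- A map from Y in `Cogen C` to H₀ × E lifts along ω₁: Ext-injectivity handles H₀ and the
  -- approximation handles E. The image of ω₁ meets ker ρ trivially, so Y has no nonzero map to ker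
  -- ρ.
  have hker : IsCogeneratedBy A E' (LinearMap.ker ρ) := by
    refine hcog (ModuleCat.of A (LinearMap.ker ρ)) fun Y hY φ => ?_
    obtain ⟨I, s, r, hrs⟩ := hC₀.exists_retraction
    obtain ⟨k, hk⟩ := exists_lift_of_essential hK j hj β hjβ hβ (fun S =>
      ((hext S ((cogen_iff.1 hY).submodule S)).pi I).of_retraction s r hrs)
      (LinearMap.fst A H₀ E ∘ₗ (LinearMap.ker ρ).subtype ∘ₗ φ)
    obtain ⟨m, hm⟩ := hg.2 Y hY
      (LinearMap.snd A H₀ E ∘ₗ (LinearMap.ker ρ).subtype ∘ₗ φ - g' ∘ₗ k)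
    refine LinearMap.ext fun y => ?_
    have h1 : ω₁ (k y + j (m y)) = (φ y).1 := by
      refine Prod.ext ?_ ?_
      · have h1 : β (k y) = (φ y).1.1 := LinearMap.congr_fun hk y
        have h2 : β (j (m y)) = 0 := (hjβ _).2 ⟨_, rfl⟩
        simp [ω₁, h1, h2]
      · have h1 : g (m y) = (φ y).1.2 - g' (k y) := LinearMap.congr_fun hm y
        simp [ω₁, hg', h1]
    have h2 : (φ y).1 = 0 := by
      rw [← h1, hω₁, ← hρω, h1]
      exact (φ y).2
    exact Subtype.ext h2
  -- The component of ω in E' is zero, so a liftable map into E' must vanish.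
  have hXE' : ∀ φ : X →ₗ[A] E', φ = 0 := fun φ => by
    obtain ⟨k, hk⟩ := hX (LinearMap.inr A I₁ E' ∘ₗ φ)
    ext y
    exact (congrArg Prod.snd (LinearMap.congr_fun hk y)).symm
  let f' : X →ₗ[A] H₀ × E := LinearMap.inr A H₀ E ∘ₗ f
  have hf' : ∀ y, f' y = t (ρ (f' y)) := fun y => by
    let δ : X →ₗ[A] LinearMap.ker ρ := (f' - t ∘ₗ ρ ∘ₗ f').codRestrict _ fun y => by
      simp [hρ]
    by_contra h
    obtain ⟨φ, hφ⟩ := hker (δ y) fun h0 => h (sub_eq_zero.1 (congrArg Subtype.val h0))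
    exact hφ (LinearMap.congr_fun (hXE' (φ ∘ₗ δ)) y)
  obtain ⟨I, s, r, hrs⟩ := hC₁.exists_retraction
  have hI₁E' := injective_prod hI₁ hE'
  -- C₁ is a retract of C^I, whose copresentation ω^I inherits lifting from ω.
  obtain ⟨k, hk⟩ := exists_lift_of_retract hK hH (j ∘ₗ i) (hj.comp hi) β₁ hjβ₁ hβ₁
    (Module.Injective.pi A fun _ : I => I₀) (Module.Injective.pi A fun _ : I => I₁ × E')
    (LinearMap.pi fun a : I => ι ∘ₗ LinearMap.proj a)
    (fun c d h => funext fun a => hι (congrFun h a))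
    (LinearMap.pi fun a : I => ω ∘ₗ LinearMap.proj a)
    (fun z => by
      constructor
      · intro h
        choose c hc using fun a => (hιω (z a)).1 (congrFun h a)
        exact ⟨c, funext hc⟩
      · rintro ⟨c, rfl⟩
        exact funext fun a => (hιω _).2 ⟨c a, rfl⟩)
    s r hrs (fun h => by
      choose k hk using fun a => hX (LinearMap.proj a ∘ₗ h)
      exact ⟨LinearMap.pi k, LinearMap.ext fun y => funext fun a =>
        LinearMap.congr_fun (hk a) y⟩)
    (ρ ∘ₗ f')
  have hk' : ∀ y, ω₁ (k y) = f' y := fun y => by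
    have : β₁ (k y) = ρ (f' y) := LinearMap.congr_fun hk y
    rw [← ht, this, ← hf']
  -- The H₀-component of f' is zero, so k takes values in ker β = C₀, and f = g ∘ l.
  obtain ⟨l, hl⟩ := exists_lift_of_mem_range j hj k fun y =>
    (hjβ _).1 (congrArg Prod.fst (hk' y))
  refine ⟨l, fun h => hf ?_⟩
  have h1 : g' (k x) = f x := congrArg Prod.snd (hk' x)
  rw [← h1, ← hl, hg', h, map_zero]

end

end CosiltingModules

theorem mainTheorem6 {A : Type u} [Ring A] [Small.{v} A] (C : ModuleCat.{v} A) :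
    List.TFAE [
      CosiltingModules.IsCosilting C,
      CosiltingModules.IsTorsionfreeClass (CosiltingModules.Cogen C) ∧
        CosiltingModules.IsCotilting (CosiltingModules.overQuotientAnn C),
      CosiltingModules.IsExtInjective (CosiltingModules.Cogen C) C ∧
        ∃ E : ModuleCat.{v} A, CosiltingModules.IsInjectiveCogenerator E ∧
          ∃ (C₁ C₀ : ModuleCat.{v} A) (i : C₁ →ₗ[A] C₀) (g : C₀ →ₗ[A] E),
            Function.Injective i ∧ Function.Exact i g ∧
              CosiltingModules.ProdClass C C₁ ∧ CosiltingModules.ProdClass C C₀ ∧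
              CosiltingModules.IsRightApproximation (CosiltingModules.Cogen C) g] := by
  tfae_have 1 → 2 := CosiltingModules.isTorsionfreeClass_and_isCotilting
  tfae_have 2 → 3 := fun h => CosiltingModules.isExtInjective_and_exists_approximation h.1 h.2
  tfae_have 3 → 1 := by
    rintro ⟨hC, E, hE, C₁, C₀, i, g, hi, hig, hC₁, hC₀, hg⟩
    exact CosiltingModules.isCosilting_of_approximation hC hE i g hi hig hC₁ hC₀ hg
  tfae_finish
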